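/- For \(k\ge 1\) let \(M_k\) be the complex \(k\times k\) matrices with the usual trace \(\mathrm{Tr}\), let \(\varepsilon_{ij}\in M_k\) be the matrix with entry \(1\) at position \((i,j)\) and \(0\) elsewhere, let \(l_\infty^k=\mathbb C^k\) be the direct sum of \(k\) copies of \(\mathbb C\), and let \(e_1,\dots,e_k\) be the standard basis of \(\mathbb C^k\). Let \(\mathcal M=\bigoplus_{k\ge1}M_k\) and \(\mathcal N=\bigoplus_{k\ge1}l_\infty^k\), with the traces \(\sum_k\mathrm{Tr}(x_k)\) and \(\sum_k\sum_{i=1}^k f_{k,i}\). For \(1\le r<\infty\), \(L_r(\mathcal M)\) is the space of all families \(x=\bigoplus_k x_k\), \(x_k\in M_k\), with \(\|x\|_r=\big(\sum_k\mathrm{Tr}(|x_k|^r)\big)^{1/r}<\infty\), and \(L_r(\mathcal N)\) is the space of all families \(f=\bigoplus_k (f_{k,i})_{i\le k}\) with \(\|f\|_r=\big(\sum_k\sum_{i=1}^k|f_{k,i}|^r\big)^{1/r}<\infty\). For a direct sum \(\mathcal A\) of matrix algebras (such as \(\mathcal M\), \(\mathcal N\)), an element of \(L_r(\mathcal A)\otimes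 M_n\) (an \(n\times n\) matrix over \(L_r(\mathcal A)\)) is called positive, written \(\ge0\), if it is positive as an operator, i.e. if each of its blocks is a positive semidefinite matrix. For \(x\in L_r(\mathcal A)\otimes M_n\) let \[ \|x\|_{r,n}=\inf\Big\{\tfrac12(\|f\|_r+\|g\|_r)\ \Big|\ f,g\in L_r(\mathcal A),\ f,g\ge0,\ \begin{bmatrix} f\otimes 1_n & x\\ x^* & g\otimes 1_n\end{bmatrix}\ge0\Big\}. \] For a linear map \(T:L_p(\mathcal A)\to L_q(\mathcal B)\) put \(T_n([x_{ij}])=[T(x_{ij})]\). \(T\) is completely positive if every \(T_n\) maps positive elements to positive elements; \(T\) is completely order bounded if \[ \|T\|_{cob}=\sup\{\|T_n(x)\|_{q,n}\mid n\in\mathbb N,\ x\in L_p(\mathcal A)\otimes M_n,\ \|x\|_{p,n}\le1\}<\infty; \] \(T\) is decomposable if there are completely positive linear maps \(S_1,S_2:L_p(\mathcal A)\to L_q(\mathcal B)\) such that the map \(L_p(\mathcal A)\otimes M_2\to L_q(\mathcal B)\otimes M_2\), \[ \begin{bmatrix}x_{11}&x_{12}\\x_{21}&x_{22}\end{bmatrix}\mapsto\begin{bmatrix}S_1(x_{11})&T(x_{12})\\T(x_{21}^*)^*&S_2(x_{22})\end{bmatrix},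 \] is completely positive. Let \(1\le p,q<\infty\) with \(q>2p\). Then \[ T\Big(\bigoplus_{k\ge1}x_k\Big)=\bigoplus_{k\ge1}T_k(x_k),\qquad T_k(x_k)=\sum_{i=1}^k\mathrm{Tr}\big((\varepsilon_{1i}+\varepsilon_{i1})x_k\big)e_i, \] is a well-defined linear map \(T:L_p(\mathcal M)\to L_q(\mathcal N)\). It is completely order bounded with \(\|T\|_{cob}\le2\), and it is not decomposable. -/

import Mathlib

noncomputable section

namespace NCLp

open Matrix
open scoped ComplexOrder

/-! ### Schatten norms of square matrices -/

section Schatten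

variable {m : Type*} [Fintype m] [DecidableEq m]

/-- The eigenvalues of `|a| = (aᴴ a)^(1/2)`, repeated according to multiplicity. -/
def absEigenvalue (a : Matrix m m ℂ) (i : m) : ℝ :=
  √((isHermitian_conjTranspose_mul_self a).eigenvalues i)

/-- `Tr (|a| ^ p)`, the `p`-th power of the Schatten norm `‖a‖_p`. -/
def trAbsPow (p : ℝ) (a : Matrix m m ℂ) : ℝ := ∑ i, absEigenvalue a i ^ p

theorem absEigenvalue_nonneg (a : Matrix m m ℂ) (i : m) : 0 ≤ absEigenvalue a i :=
  Real.sqrt_nonneg _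

theorem trAbsPow_nonneg (p : ℝ) (a : Matrix m m ℂ) : 0 ≤ trAbsPow p a :=
  Finset.sum_nonneg fun i _ => Real.rpow_nonneg (absEigenvalue_nonneg a i) p

/-- Singular value decomposition. -/
theorem exists_svd (a : Matrix m m ℂ) :
    ∃ e f : OrthonormalBasis m ℂ (EuclideanSpace ℂ m),
      ∀ i, toEuclideanLin a (e i) = (absEigenvalue a i : ℂ) • f i := by
  set hA := isHermitian_conjTranspose_mul_self a with hAdef
  set e := hA.eigenvectorBasis with he
  have hev : ∀ j, toEuclideanLin aᴴ (toEuclideanLin a (e j)) = (hA.eigenvalues j : ℂ) • e j := by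
    intro j
    have h := hA.mulVec_eigenvectorBasis j
    apply (WithLp.ofLp_injective 2)
    simpa [toLpLin_apply, mulVec_mulVec] using h
  have hin : ∀ i j, inner ℂ (toEuclideanLin a (e i)) (toEuclideanLin a (e j))
      = if i = j then (hA.eigenvalues j : ℂ) else 0 := by
    intro i j
    rw [← LinearMap.adjoint_inner_right, ← toEuclideanLin_conjTranspose_eq_adjoint, hev,
      inner_smul_right, orthonormal_iff_ite.mp e.orthonormal]
    simp
  have hnn : ∀ i, 0 ≤ hA.eigenvalues i := (posSemidef_conjTranspose_mul_self a).eigenvalues_nonneg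
  have hsq : ∀ i, ((absEigenvalue a i : ℝ) : ℂ) * (absEigenvalue a i : ℂ)
      = (hA.eigenvalues i : ℂ) := by
    intro i
    rw [← Complex.ofReal_mul]
    congr 1
    exact Real.mul_self_sqrt (hnn i)
  let v : m → EuclideanSpace ℂ m :=
    fun i => ((absEigenvalue a i : ℂ))⁻¹ • toEuclideanLin a (e i)
  have hv : Orthonormal ℂ (({i | absEigenvalue a i ≠ 0} : Set m).domRestrict v) := by
    rw [orthonormal_iff_ite]
    rintro ⟨i, hi⟩ ⟨j, hj⟩
    have hj' : (absEigenvalue a j : ℂ) ≠ 0 := by exact_mod_cast hj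
    simp only [Set.domRestrict_apply, v, inner_smul_left, inner_smul_right, hin, Subtype.mk.injEq]
    split_ifs with h
    · subst h
      rw [← hsq]
      simp only [map_inv₀, Complex.conj_ofReal]
      field_simp
    · simp
  obtain ⟨f, hf⟩ := hv.exists_orthonormalBasis_extension_of_card_eq (by simp)
  refine ⟨e, f, fun i => ?_⟩
  by_cases hi : absEigenvalue a i = 0
  · have h0 : inner ℂ (toEuclideanLin a (e i)) (toEuclideanLin a (e i)) = 0 := by
      rw [hin, if_pos rfl, ← hsq, hi]; simp
    rw [inner_self_eq_zero.mp h0, hi]; simp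
  · have hi' : (absEigenvalue a i : ℂ) ≠ 0 := by exact_mod_cast hi
    rw [hf i hi, smul_smul, mul_inv_cancel₀ hi', one_smul]

/-- The diagonal of `a` with respect to two orthonormal bases is dominated by the Schatten norm. -/
theorem sum_norm_inner_rpow_le {p : ℝ} (hp : 1 ≤ p) (a : Matrix m m ℂ)
    (u v : OrthonormalBasis m ℂ (EuclideanSpace ℂ m)) :
    ∑ i, ‖inner ℂ (v i) (toEuclideanLin a (u i))‖ ^ p ≤ trAbsPow p a := by
  obtain ⟨e, f, hef⟩ := exists_svd a
  let D : m → m → ℝ := fun i j =>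
    (‖inner ℂ (e j) (u i)‖ ^ 2 + ‖inner ℂ (v i) (f j)‖ ^ 2) / 2
  have hD0 : ∀ i j, 0 ≤ D i j := fun i j => by positivity
  have hD1 : ∀ i, ∑ j, D i j = 1 := by
    intro i
    simp only [D]
    rw [← Finset.sum_div, Finset.sum_add_distrib, e.sum_sq_norm_inner_right,
      f.sum_sq_norm_inner_left]
    simp
  have hD2 : ∀ j, ∑ i, D i j = 1 := by
    intro j
    simp only [D]
    rw [← Finset.sum_div, Finset.sum_add_distrib, u.sum_sq_norm_inner_left,
      v.sum_sq_norm_inner_right]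
    simp
  have hle : ∀ i, ‖inner ℂ (v i) (toEuclideanLin a (u i))‖ ≤ ∑ j, D i j * absEigenvalue a j := by
    intro i
    have h1 : toEuclideanLin a (u i)
        = ∑ j, inner ℂ (e j) (u i) • ((absEigenvalue a j : ℂ) • f j) := by
      conv_lhs => rw [← e.sum_repr' (u i)]
      simp [map_sum, hef]
    rw [h1, inner_sum]
    refine (norm_sum_le _ _).trans (Finset.sum_le_sum fun j _ => ?_)
    rw [inner_smul_right, inner_smul_right, norm_mul, norm_mul, Complex.norm_real,
      Real.norm_of_nonneg (absEigenvalue_nonneg a j)]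
    have h2 : ‖inner ℂ (e j) (u i)‖ * ‖inner ℂ (v i) (f j)‖ ≤ D i j := by
      simp only [D]
      nlinarith [sq_nonneg (‖inner ℂ (e j) (u i)‖ - ‖inner ℂ (v i) (f j)‖)]
    calc _ = (‖inner ℂ (e j) (u i)‖ * ‖inner ℂ (v i) (f j)‖) * absEigenvalue a j := by ring
      _ ≤ _ := mul_le_mul_of_nonneg_right h2 (absEigenvalue_nonneg a j)
  calc ∑ i, ‖inner ℂ (v i) (toEuclideanLin a (u i))‖ ^ p
      ≤ ∑ i, ∑ j, D i j * absEigenvalue a j ^ p := by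
        refine Finset.sum_le_sum fun i _ => ?_
        refine (Real.rpow_le_rpow (norm_nonneg _) (hle i) (by linarith)).trans ?_
        exact Real.rpow_arith_mean_le_arith_mean_rpow _ _ _ (fun j _ => hD0 i j) (hD1 i)
          (fun j _ => absEigenvalue_nonneg a j) hp
    _ = trAbsPow p a := by
        rw [Finset.sum_comm]
        simp only [← Finset.sum_mul, hD2, one_mul, trAbsPow]

theorem exists_trAbsPow_eq (p : ℝ) (a : Matrix m m ℂ) :
    ∃ u v : OrthonormalBasis m ℂ (EuclideanSpace ℂ m),
      trAbsPow p a = ∑ i, ‖inner ℂ (v i) (toEuclideanLin a (u i))‖ ^ p := by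
  obtain ⟨e, f, hef⟩ := exists_svd a
  refine ⟨e, f, Finset.sum_congr rfl fun i _ => ?_⟩
  rw [hef, inner_smul_right, orthonormal_iff_ite.mp f.orthonormal]
  simp [abs_of_nonneg (absEigenvalue_nonneg a i)]

theorem trAbsPow_add_le {p : ℝ} (hp : 1 ≤ p) (a b : Matrix m m ℂ) :
    trAbsPow p (a + b) ≤ 2 ^ (p - 1) * (trAbsPow p a + trAbsPow p b) := by
  obtain ⟨u, v, h⟩ := exists_trAbsPow_eq p (a + b)
  rw [h]
  refine le_trans ?_ (mul_le_mul_of_nonneg_left (add_le_add (sum_norm_inner_rpow_le hp a u v)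
    (sum_norm_inner_rpow_le hp b u v)) (by positivity))
  rw [← Finset.sum_add_distrib, Finset.mul_sum]
  refine Finset.sum_le_sum fun i _ => ?_
  rw [map_add, LinearMap.add_apply, inner_add_right]
  refine (Real.rpow_le_rpow (norm_nonneg _) (norm_add_le _ _) (by linarith)).trans ?_
  have h := NNReal.rpow_add_le_mul_rpow_add_rpow (nnnorm (inner ℂ (v i) (toEuclideanLin a (u i))))
    (nnnorm (inner ℂ (v i) (toEuclideanLin b (u i)))) hp
  exact_mod_cast h

theorem trAbsPow_smul_le {p : ℝ} (hp : 1 ≤ p) (c : ℂ) (a : Matrix m m ℂ) :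
    trAbsPow p (c • a) ≤ ‖c‖ ^ p * trAbsPow p a := by
  obtain ⟨u, v, h⟩ := exists_trAbsPow_eq p (c • a)
  rw [h]
  refine le_trans (le_of_eq ?_) (mul_le_mul_of_nonneg_left (sum_norm_inner_rpow_le hp a u v)
    (by positivity))
  rw [Finset.mul_sum]
  refine Finset.sum_congr rfl fun i _ => ?_
  rw [map_smul, LinearMap.smul_apply, inner_smul_right, norm_mul,
    Real.mul_rpow (norm_nonneg _) (norm_nonneg _)]

theorem trAbsPow_conjTranspose_le {p : ℝ} (hp : 1 ≤ p) (a : Matrix m m ℂ) :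
    trAbsPow p aᴴ ≤ trAbsPow p a := by
  obtain ⟨u, v, h⟩ := exists_trAbsPow_eq p aᴴ
  rw [h]
  refine le_trans (le_of_eq ?_) (sum_norm_inner_rpow_le hp a v u)
  refine Finset.sum_congr rfl fun i _ => ?_
  rw [toEuclideanLin_conjTranspose_eq_adjoint, LinearMap.adjoint_inner_right, norm_inner_symm]

theorem trAbsPow_zero {p : ℝ} (hp : 1 ≤ p) : trAbsPow p (0 : Matrix m m ℂ) = 0 := by
  refine le_antisymm ?_ (trAbsPow_nonneg p _)
  have h := trAbsPow_smul_le hp 0 (0 : Matrix m m ℂ)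
  rwa [zero_smul, norm_zero, Real.zero_rpow (by linarith), zero_mul] at h

end Schatten

/-! ### The space `L_p` of a direct sum of matrix algebras -/

section BlockLp

variable {ι : Type*} (d : ι → Type*) [∀ k, Fintype (d k)] [∀ k, DecidableEq (d k)]

/-- The space `L_p(⊕_{k ∈ ι} M_{d k})` of the von Neumann algebra `⊕_{k ∈ ι} M_{d k}` with the trace
`⊕ x_k ↦ ∑_k Tr x_k`: the families `x = ⊕ x_k` of matrices with `∑_k ‖x_k‖_p ^ p < ∞`. -/
def BlockLp (p : ℝ) [hp : Fact (1 ≤ p)] : Submodule ℂ (∀ k, Matrix (d k) (d k) ℂ) where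
  carrier := {x | Summable fun k => trAbsPow p (x k)}
  zero_mem' := by simp [trAbsPow_zero hp.out, summable_zero]
  add_mem' {x y} hx hy :=
    Summable.of_nonneg_of_le (fun _ => trAbsPow_nonneg p _)
      (fun k => trAbsPow_add_le hp.out (x k) (y k))
      ((Summable.add hx hy).mul_left (2 ^ (p - 1)))
  smul_mem' c x hx :=
    Summable.of_nonneg_of_le (fun _ => trAbsPow_nonneg p _)
      (fun k => trAbsPow_smul_le hp.out c (x k)) (Summable.mul_left (‖c‖ ^ p) hx)

variable {d} {p : ℝ} [hp : Fact (1 ≤ p)]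

/-- The adjoint is taken in every block. -/
instance : Star (BlockLp d p) where
  star x := ⟨fun k => (x.1 k)ᴴ,
    Summable.of_nonneg_of_le (fun _ => trAbsPow_nonneg p _)
      (fun k => trAbsPow_conjTranspose_le hp.out (x.1 k)) x.2⟩

/-- The norm `‖x‖_p = (∑_k ‖x_k‖_p ^ p) ^ (1 / p)` of `L_p`. -/
def lpNorm (x : BlockLp d p) : ℝ := (∑' k, trAbsPow p (x.1 k)) ^ (1 / p)

/-- A square matrix with entries in `L_p`, as an element of `L_p ⊗ M_s`, is positive if it is a
positive operator, i.e. if each of its blocks, an element of `M_{d k} ⊗ M_s`, is positive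
semidefinite. -/
def MatPos {s : Type*} (x : Matrix s s (BlockLp d p)) : Prop :=
  ∀ k, (Matrix.of fun a b : s × d k => (x a.1 b.1).1 k a.2 b.2).PosSemidef

/-- The positive cone of `L_p`. -/
def IsPos (f : BlockLp d p) : Prop := ∀ k, (f.1 k).PosSemidef

/-- The norm `‖x‖_{p,n}` on `L_p ⊗ M_n`: the infimum of `(‖f‖_p + ‖g‖_p) / 2` over all positive
`f, g ∈ L_p` such that the operator matrix `[f ⊗ 1_n, x; x^*, g ⊗ 1_n]` is positive. -/
def matrixNorm {n : ℕ} (x : Matrix (Fin n) (Fin n) (BlockLp d p)) : ENNReal :=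
  ⨅ (f : BlockLp d p) (g : BlockLp d p) (_ : IsPos f) (_ : IsPos g)
    (_ : MatPos (fromBlocks (diagonal fun _ => f) x xᴴ (diagonal fun _ => g))),
    ENNReal.ofReal ((lpNorm f + lpNorm g) / 2)

end BlockLp

/-! ### Completely order bounded and decomposable maps -/

section Maps

variable {ι κ : Type*} {d : ι → Type*} [∀ k, Fintype (d k)] [∀ k, DecidableEq (d k)]
  {d' : κ → Type*} [∀ k, Fintype (d' k)] [∀ k, DecidableEq (d' k)]
  {p q : ℝ} [Fact (1 ≤ p)] [Fact (1 ≤ q)]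

/-- `‖T‖_cob`, the supremum of `‖T_n(x)‖_{q,n}` over all `n` and all `x ∈ L_p ⊗ M_n` with
`‖x‖_{p,n} ≤ 1`, where `T_n [x_{ij}] = [T x_{ij}]`. -/
def cobNorm (T : BlockLp d p →ₗ[ℂ] BlockLp d' q) : ENNReal :=
  ⨆ (n : ℕ) (x : Matrix (Fin n) (Fin n) (BlockLp d p)) (_ : matrixNorm x ≤ 1),
    matrixNorm (x.map T)

def CompletelyOrderBounded (T : BlockLp d p →ₗ[ℂ] BlockLp d' q) : Prop := cobNorm T < ⊤

def CompletelyPositive (T : BlockLp d p →ₗ[ℂ] BlockLp d' q) : Prop :=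
  ∀ (n : ℕ) (x : Matrix (Fin n) (Fin n) (BlockLp d p)), MatPos x → MatPos (x.map T)

/-- The map `[x₁₁, x₁₂; x₂₁, x₂₂] ↦ [S₁ x₁₁, T x₁₂; T (x₂₁^*)^*, S₂ x₂₂]` on `L_p ⊗ M_2`. -/
def decompMap (S₁ T S₂ : BlockLp d p →ₗ[ℂ] BlockLp d' q)
    (x : Matrix (Fin 2) (Fin 2) (BlockLp d p)) : Matrix (Fin 2) (Fin 2) (BlockLp d' q) :=
  !![S₁ (x 0 0), T (x 0 1); star (T (star (x 1 0))), S₂ (x 1 1)]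

/-- Complete positivity of a map `L_p ⊗ M_2 → L_q ⊗ M_2`; an `n × n` matrix with entries in
`L_p ⊗ M_2` is regarded as an element of `L_p ⊗ M_2 ⊗ M_n`. -/
def CompletelyPositiveTwo
    (Φ : Matrix (Fin 2) (Fin 2) (BlockLp d p) → Matrix (Fin 2) (Fin 2) (BlockLp d' q)) : Prop :=
  ∀ (n : ℕ) (x : Matrix (Fin n) (Fin n) (Matrix (Fin 2) (Fin 2) (BlockLp d p))),
    MatPos (Matrix.of fun a b : Fin n × Fin 2 => x a.1 b.1 a.2 b.2) →
    MatPos (Matrix.of fun a b : Fin n × Fin 2 => Φ (x a.1 b.1) a.2 b.2)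

/-- `T` is decomposable. -/
def Decomposable (T : BlockLp d p →ₗ[ℂ] BlockLp d' q) : Prop :=
  ∃ S₁ S₂ : BlockLp d p →ₗ[ℂ] BlockLp d' q,
    CompletelyPositive S₁ ∧ CompletelyPositive S₂ ∧ CompletelyPositiveTwo (decompMap S₁ T S₂)

end Maps

/-! ### The two direct sums -/

/-- `L_p(⊕_{k ≥ 1} M_k)`; the natural number `k` indexes the summand `M_{k+1}`. -/
abbrev LpM (p : ℝ) [Fact (1 ≤ p)] : Submodule ℂ (∀ k : ℕ, Matrix (Fin (k + 1)) (Fin (k + 1)) ℂ) :=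
  BlockLp (fun k : ℕ => Fin (k + 1)) p

/-- `L_q(⊕_{k ≥ 1} l_∞^k)`, where `l_∞^k` is the direct sum of `k` copies of `ℂ = M_1`: the summands
are indexed by the pairs `(k, i)` where `k` stands for `l_∞^{k+1}` and `i` for its `i`-th
coordinate, counted from `0`. -/
abbrev LqN (q : ℝ) [Fact (1 ≤ q)] : Submodule ℂ (∀ _ : (Σ k : ℕ, Fin (k + 1)), Matrix Unit Unit ℂ) :=
  BlockLp (fun _ : (Σ k : ℕ, Fin (k + 1)) => Unit) q

end NCLp

end

noncomputable section

namespace NCLp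

open Matrix
open scoped ComplexOrder

/-! Coordinate `(k, i)` of the image is `x_{i0} + x_{0i}` (indices from `0`), and for matrix-valued
`x` these entries become scalar matrices `X_{i0}`, `X_{0i}`.

Order boundedness: if `f, g` dominate `x`, compressing gives `‖X_{rc}‖² ≤ f_{rr} g_{cc}`
(`submatrix_block`). Hence `‖X_{i0} + X_{0i}‖² ≤ D_i D_0` with `D` the diagonal of `f + g`, by
`posSemidef_fromBlocks_smul_one_add`. The `ℓ_p` norm of `D` is at most `‖f‖_p + ‖g‖_p`, and since
`q/2 ≥ p`, the family `√(D_i D_0)` has no larger `ℓ_q` norm (`summable_sqrt_mul_rpow`).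

Non-decomposability: a decomposition gives a positive `S = S₁ + S₂` with `S x ≥ -2 T x` on the
positive cone. Testing on `(e_0 ± t e_i)(e_0 ± t e_i)^*` shows that the values `φ₀, φ₁` of `S` at
`ε_{00}`, `ε_{ii}` in coordinate `(k, i)` satisfy `2t ≤ φ₀ + t² φ₁`, so they cannot both be small
(`two_mul_le_of_dominates`). For `x₀ = ⊕ c_k ε_{00}`, membership of `S x₀` in `L_q` makes some
coordinate `i = i(k)` of size `O(k^{-1/q})`. Then `S` of `⊕ c_k ε_{i(k)i(k)}` is at least a constant
times `c_k² k^{1/q}` there. With `c_k` supported on a sparse set of `k`, this stays bounded below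
infinitely often, a contradiction (`not_exists_positive_dominates`). -/

theorem rpow_le_rpow_mul {a A r : ℝ} (ha : 0 ≤ a) (haA : a ≤ A) (hr : 1 ≤ r) :
    a ^ r ≤ A ^ (r - 1) * a := by
  have h : a ^ r = a ^ (r - 1) * a := by
    conv_lhs => rw [← sub_add_cancel r 1]
    rw [Real.rpow_add_of_nonneg ha (by linarith) zero_le_one, Real.rpow_one]
  rw [h]
  exact mul_le_mul_of_nonneg_right (Real.rpow_le_rpow ha haA (by linarith)) ha

theorem summable_rpow_and_tsum_rpow_le {α : Type*} {a : α → ℝ} (ha : ∀ i, 0 ≤ a i)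
    (hs : Summable a) {r : ℝ} (hr : 1 ≤ r) :
    Summable (fun i => a i ^ r) ∧ ∑' i, a i ^ r ≤ (∑' i, a i) ^ r := by
  have hA : 0 ≤ ∑' i, a i := tsum_nonneg ha
  have hle : ∀ i, a i ^ r ≤ (∑' i, a i) ^ (r - 1) * a i := fun i =>
    rpow_le_rpow_mul (ha i) (hs.le_tsum i fun j _ => ha j) hr
  have h1 : Summable fun i => (∑' i, a i) ^ (r - 1) * a i := hs.mul_left _
  have h2 : Summable fun i => a i ^ r :=
    Summable.of_nonneg_of_le (fun i => Real.rpow_nonneg (ha i) r) hle h1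
  refine ⟨h2, (h2.tsum_le_tsum hle h1).trans (le_of_eq ?_)⟩
  rw [tsum_mul_left]
  conv_rhs => rw [← sub_add_cancel r 1]
  rw [Real.rpow_add_of_nonneg hA (by linarith) zero_le_one, Real.rpow_one]

theorem sum_rpow_le {α : Type*} [Fintype α] {a : α → ℝ} (ha : ∀ i, 0 ≤ a i) {r : ℝ}
    (hr : 1 ≤ r) : ∑ i, a i ^ r ≤ (∑ i, a i) ^ r := by
  simpa [tsum_fintype] using
    (summable_rpow_and_tsum_rpow_le ha (hasSum_fintype a).summable hr).2

/-! ### Entries, rows and columns against Schatten norms -/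

section Schatten

variable {m : Type*} [Fintype m] [DecidableEq m]

theorem inner_basisFun_toEuclideanLin (a : Matrix m m ℂ) (i j : m) :
    inner ℂ (EuclideanSpace.basisFun m ℂ i)
      (toEuclideanLin a (EuclideanSpace.basisFun m ℂ j)) = a i j := by
  simp [EuclideanSpace.inner_single_left, toLpLin_apply]

theorem sum_norm_diag_rpow_le {p : ℝ} (hp : 1 ≤ p) (a : Matrix m m ℂ) :
    ∑ i, ‖a i i‖ ^ p ≤ trAbsPow p a := by
  simpa only [inner_basisFun_toEuclideanLin] using
    sum_norm_inner_rpow_le hp a (EuclideanSpace.basisFun m ℂ) (EuclideanSpace.basisFun m ℂ)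

/-- Each singular value is at most the Schatten norm, and in the singular bases `a` acts by
multiplication by its singular values. -/
theorem norm_toEuclideanLin_sq_le {p : ℝ} (hp : 1 ≤ p) (a : Matrix m m ℂ)
    (x : EuclideanSpace ℂ m) :
    ‖toEuclideanLin a x‖ ^ 2 ≤ (trAbsPow p a ^ (1 / p)) ^ 2 * ‖x‖ ^ 2 := by
  obtain ⟨e, f, hef⟩ := exists_svd a
  have hp0 : 0 < p := by linarith
  have hσ : ∀ j, absEigenvalue a j ≤ trAbsPow p a ^ (1 / p) := by
    intro j
    have h : absEigenvalue a j ^ p ≤ trAbsPow p a :=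
      Finset.single_le_sum (f := fun j => absEigenvalue a j ^ p)
        (fun i _ => Real.rpow_nonneg (absEigenvalue_nonneg a i) p) (Finset.mem_univ j)
    have h' := Real.rpow_le_rpow (Real.rpow_nonneg (absEigenvalue_nonneg a j) p) h
      (by positivity : 0 ≤ 1 / p)
    rwa [← Real.rpow_mul (absEigenvalue_nonneg a j), mul_one_div_cancel hp0.ne',
      Real.rpow_one] at h'
  have hinner : ∀ j, inner ℂ (f j) (toEuclideanLin a x)
      = absEigenvalue a j * inner ℂ (e j) x := by
    intro j
    have h1 : toEuclideanLin a x
        = ∑ j, inner ℂ (e j) x • ((absEigenvalue a j : ℂ) • f j) := by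
      conv_lhs => rw [← e.sum_repr' x]
      simp [map_sum, hef]
    rw [h1, inner_sum, Finset.sum_eq_single j]
    · simp [inner_smul_right, mul_comm]
    · intro i _ hij
      simp [inner_smul_right, orthonormal_iff_ite.mp f.orthonormal, hij.symm]
    · simp
  rw [← f.sum_sq_norm_inner_right, ← e.sum_sq_norm_inner_right x, Finset.mul_sum]
  refine Finset.sum_le_sum fun j _ => ?_
  rw [hinner, norm_mul, mul_pow, Complex.norm_real,
    Real.norm_of_nonneg (absEigenvalue_nonneg a j)]
  exact mul_le_mul_of_nonneg_right
    (pow_le_pow_left₀ (absEigenvalue_nonneg a j) (hσ j) 2) (by positivity)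

theorem sum_norm_col_sq_le {p : ℝ} (hp : 1 ≤ p) (a : Matrix m m ℂ) (j : m) :
    ∑ i, ‖a i j‖ ^ 2 ≤ (trAbsPow p a ^ (1 / p)) ^ 2 := by
  have h := norm_toEuclideanLin_sq_le hp a (EuclideanSpace.basisFun m ℂ j)
  rw [← (EuclideanSpace.basisFun m ℂ).sum_sq_norm_inner_right] at h
  simpa only [inner_basisFun_toEuclideanLin, OrthonormalBasis.norm_eq_one, one_pow,
    mul_one] using h

theorem sum_norm_row_sq_le {p : ℝ} (hp : 1 ≤ p) (a : Matrix m m ℂ) (j : m) :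
    ∑ i, ‖a j i‖ ^ 2 ≤ (trAbsPow p a ^ (1 / p)) ^ 2 := by
  have h := sum_norm_col_sq_le hp aᴴ j
  simp only [conjTranspose_apply, norm_star] at h
  refine h.trans (pow_le_pow_left₀ (Real.rpow_nonneg (trAbsPow_nonneg p _) _) ?_ 2)
  exact Real.rpow_le_rpow (trAbsPow_nonneg p _) (trAbsPow_conjTranspose_le hp a)
    (by positivity)

/-- For a rank-one projection, AM-GM and Parseval already bound the sum of the matrix coefficients
`|⟨v_j, e_i⟩⟨e_i, u_j⟩|` by `1`; passing to `p`-th powers only helps. -/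
theorem trAbsPow_single_self_le {p : ℝ} (hp : 1 ≤ p) (i : m) :
    trAbsPow p (single i i (1 : ℂ)) ≤ 1 := by
  obtain ⟨u, v, h⟩ := exists_trAbsPow_eq p (single i i (1 : ℂ))
  have hnorm : ‖EuclideanSpace.basisFun m ℂ i‖ = 1 := OrthonormalBasis.norm_eq_one _ i
  have hS : ∀ x : EuclideanSpace ℂ m, toEuclideanLin (single i i (1 : ℂ)) x
      = inner ℂ (EuclideanSpace.basisFun m ℂ i) x • EuclideanSpace.basisFun m ℂ i := by
    intro x
    apply WithLp.ofLp_injective 2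
    ext j
    simp [toLpLin_apply, EuclideanSpace.inner_single_left, single_mulVec,
      Function.update_apply]
  rw [h]
  refine (sum_rpow_le (fun j => norm_nonneg _) hp).trans ?_
  refine Real.rpow_le_one (Finset.sum_nonneg fun j _ => norm_nonneg _) ?_ (by linarith)
  have hle : ∀ j, ‖inner ℂ (v j) (toEuclideanLin (single i i (1 : ℂ)) (u j))‖
      ≤ (‖inner ℂ (EuclideanSpace.basisFun m ℂ i) (u j)‖ ^ 2
        + ‖inner ℂ (v j) (EuclideanSpace.basisFun m ℂ i)‖ ^ 2) / 2 := by
    intro j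
    rw [hS, inner_smul_right, norm_mul]
    nlinarith [sq_nonneg (‖inner ℂ (EuclideanSpace.basisFun m ℂ i) (u j)‖
      - ‖inner ℂ (v j) (EuclideanSpace.basisFun m ℂ i)‖)]
  refine (Finset.sum_le_sum fun j _ => hle j).trans (le_of_eq ?_)
  rw [← Finset.sum_div, Finset.sum_add_distrib, u.sum_sq_norm_inner_left,
    v.sum_sq_norm_inner_right, hnorm]
  norm_num

theorem trAbsPow_unique [Unique m] (p : ℝ) (a : Matrix m m ℂ) :
    trAbsPow p a = ‖a default default‖ ^ p := by
  obtain ⟨u, v, h⟩ := exists_trAbsPow_eq p a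
  have hv := v.sum_sq_norm_inner_right (toEuclideanLin a (u default))
  have hu : ‖u default‖ = 1 := OrthonormalBasis.norm_eq_one _ _
  rw [Fintype.sum_unique] at hv
  rw [h, Fintype.sum_unique, (sq_eq_sq₀ (norm_nonneg _) (norm_nonneg _)).1 hv]
  have h1 : toEuclideanLin a (u default) = a default default • u default := by
    apply WithLp.ofLp_injective 2
    ext j
    simp [toLpLin_apply, mulVec, dotProduct, Unique.eq_default j]
  rw [h1, norm_smul, hu, mul_one]

end Schatten

/-! ### Two-by-two operator matrices with scalar diagonal -/

section TwoByTwo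

variable {n : Type*} [Fintype n] [DecidableEq n]

theorem star_dotProduct_fromBlocks_smul_one (α β : ℝ) (X : Matrix n n ℂ) (u v : n → ℂ) :
    star (Sum.elim u v) ⬝ᵥ
        (fromBlocks ((α : ℂ) • 1) X Xᴴ ((β : ℂ) • 1) *ᵥ Sum.elim u v)
      = ((α * ∑ i, ‖u i‖ ^ 2 + β * ∑ i, ‖v i‖ ^ 2 + 2 * (star u ⬝ᵥ (X *ᵥ v)).re : ℝ) : ℂ) := by
  have hn : ∀ w : n → ℂ, star w ⬝ᵥ w = ((∑ i, ‖w i‖ ^ 2 : ℝ) : ℂ) := by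
    intro w
    simp only [dotProduct, Pi.star_apply, RCLike.star_def, Complex.conj_mul', Complex.ofReal_sum,
      Complex.ofReal_pow]
  have hc : star v ⬝ᵥ (Xᴴ *ᵥ u) = star (star u ⬝ᵥ (X *ᵥ v)) := by
    rw [star_dotProduct, star_mulVec, conjTranspose_conjTranspose, dotProduct_mulVec]
  have hs : star (Sum.elim u v) = Sum.elim (star u) (star v) := by
    ext i; cases i <;> rfl
  rw [fromBlocks_mulVec, hs, sumElim_dotProduct_sumElim]
  simp only [Sum.elim_comp_inl, Sum.elim_comp_inr, dotProduct_add, smul_mulVec, one_mulVec,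
    dotProduct_smul, hn, hc]
  have hre : star u ⬝ᵥ (X *ᵥ v) + star (star u ⬝ᵥ (X *ᵥ v))
      = ((2 * (star u ⬝ᵥ (X *ᵥ v)).re : ℝ) : ℂ) := by
    rw [RCLike.star_def, Complex.add_conj]
  push_cast at hre ⊢
  simp only [smul_eq_mul]
  linear_combination hre

theorem posSemidef_fromBlocks_smul_one_iff (α β : ℝ) (X : Matrix n n ℂ) :
    (fromBlocks ((α : ℂ) • 1) X Xᴴ ((β : ℂ) • 1)).PosSemidef ↔
      ∀ u v : n → ℂ, 0 ≤ α * ∑ i, ‖u i‖ ^ 2 + β * ∑ i, ‖v i‖ ^ 2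
        + 2 * (star u ⬝ᵥ (X *ᵥ v)).re := by
  constructor
  · intro h u v
    have h1 := h.dotProduct_mulVec_nonneg (Sum.elim u v)
    rw [star_dotProduct_fromBlocks_smul_one] at h1
    exact_mod_cast h1
  · intro h
    refine PosSemidef.of_dotProduct_mulVec_nonneg ?_ fun w => ?_
    · refine IsHermitian.fromBlocks ?_ rfl ?_ <;>
        simp [IsHermitian, conjTranspose_smul]
    · rw [← Sum.elim_comp_inl_inr w, star_dotProduct_fromBlocks_smul_one]
      exact_mod_cast h _ _

/-- For nonnegative scalars, positivity means `‖X‖² ≤ αβ`, so only the product of the diagonal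
scalars matters. -/
theorem posSemidef_fromBlocks_smul_one_of_mul_le {α β α' β' : ℝ} {X : Matrix n n ℂ}
    (h : (fromBlocks ((α : ℂ) • 1) X Xᴴ ((β : ℂ) • 1)).PosSemidef)
    (hα : 0 ≤ α') (hβ : 0 ≤ β') (hle : α * β ≤ α' * β') :
    (fromBlocks ((α' : ℂ) • 1) X Xᴴ ((β' : ℂ) • 1)).PosSemidef := by
  rw [posSemidef_fromBlocks_smul_one_iff] at h ⊢
  intro u v
  set A := ∑ i, ‖u i‖ ^ 2
  set B := ∑ i, ‖v i‖ ^ 2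
  set R := (star u ⬝ᵥ (X *ᵥ v)).re with hR
  have hA : 0 ≤ A := Finset.sum_nonneg fun i _ => by positivity
  have hB : 0 ≤ B := Finset.sum_nonneg fun i _ => by positivity
  -- Replacing `u` by `s u` with `s` real turns the form into a quadratic in `s`; its discriminant
  -- gives `R² ≤ αβAB`.
  have hd := discrim_le_zero (a := α * A) (b := 2 * R) (c := β * B) fun s => by
    have h1 := h ((s : ℂ) • u) v
    have h2 : ∑ i, ‖((s : ℂ) • u) i‖ ^ 2 = s * s * A := by
      simp only [Pi.smul_apply, norm_smul, mul_pow, Complex.norm_real, Real.norm_eq_abs, sq_abs,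
        ← Finset.mul_sum, A]
      ring
    have h3 : (star ((s : ℂ) • u) ⬝ᵥ (X *ᵥ v)).re = s * R := by
      rw [star_smul, smul_dotProduct, hR]
      simp
    rw [h2, h3] at h1
    linarith
  rw [discrim] at hd
  have h4 : R ^ 2 ≤ (α' * A) * (β' * B) := by
    nlinarith [mul_le_mul_of_nonneg_right hle (mul_nonneg hA hB)]
  have h5 : 0 ≤ α' * A := mul_nonneg hα hA
  have h6 : 0 ≤ β' * B := mul_nonneg hβ hB
  have h7 : |2 * R| ≤ α' * A + β' * B :=
    abs_le_of_sq_le_sq (by nlinarith [sq_nonneg (α' * A - β' * B)]) (by linarith)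
  linarith [(abs_le.1 h7).1]

/-- The diagonal scalars of `Y` are exchanged before adding. For `X = X_{i0}`, `Y = X_{0i}` this
groups the bound as `(f_{ii} + g_{ii})(g_{00} + f_{00})`; without the exchange a term `f_{00}
g_{00}` would recur for every `i`. -/
theorem posSemidef_fromBlocks_smul_one_add {α β γ δ : ℝ} {X Y : Matrix n n ℂ}
    (hX : (fromBlocks ((α : ℂ) • 1) X Xᴴ ((β : ℂ) • 1)).PosSemidef)
    (hY : (fromBlocks ((γ : ℂ) • 1) Y Yᴴ ((δ : ℂ) • 1)).PosSemidef)
    (hα : 0 ≤ α) (hβ : 0 ≤ β) (hγ : 0 ≤ γ) (hδ : 0 ≤ δ) :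
    (fromBlocks ((√((α + δ) * (β + γ)) : ℂ) • 1) (X + Y) (X + Y)ᴴ
      ((√((α + δ) * (β + γ)) : ℂ) • 1)).PosSemidef := by
  have hY' := posSemidef_fromBlocks_smul_one_of_mul_le hY hδ hγ (mul_comm γ δ).le
  have h : (fromBlocks (((α + δ : ℝ) : ℂ) • 1) (X + Y) (X + Y)ᴴ
      (((β + γ : ℝ) : ℂ) • 1)).PosSemidef := by
    have h1 := hX.add hY'
    rw [fromBlocks_add, ← add_smul, ← add_smul, ← conjTranspose_add] at h1
    exact_mod_cast h1
  exact posSemidef_fromBlocks_smul_one_of_mul_le h (Real.sqrt_nonneg _) (Real.sqrt_nonneg _)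
    (Real.mul_self_sqrt (by positivity)).ge

end TwoByTwo

/-! ### The map and its well-definedness -/

section RowColumn

/-- The `ℓ_2` norm of a row or column is at most the Schatten norm of the block. Since `q ≥ 2` this
controls the `ℓ_q` norm inside a block, and `q ≥ p` allows summation over blocks. -/
theorem summable_norm_col_add_row {p q : ℝ} (hp : 1 ≤ p) (hpq : p ≤ q) (hq : 2 ≤ q)
    {x : ∀ k : ℕ, Matrix (Fin (k + 1)) (Fin (k + 1)) ℂ}
    (hx : Summable fun k => trAbsPow p (x k)) :
    Summable fun s : (Σ k : ℕ, Fin (k + 1)) => ‖x s.1 s.2 0 + x s.1 0 s.2‖ ^ q := by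
  have hp0 : 0 < p := by linarith
  rw [summable_sigma_of_nonneg fun s => by positivity]
  refine ⟨fun k => (hasSum_fintype _).summable, ?_⟩
  have h1 := (summable_rpow_and_tsum_rpow_le (fun k => trAbsPow_nonneg p (x k)) hx
    ((one_le_div hp0).2 hpq)).1
  refine Summable.of_nonneg_of_le (fun k => tsum_nonneg fun i => by positivity) (fun k => ?_)
    (h1.mul_left (2 ^ q))
  rw [tsum_fintype]
  set M := trAbsPow p (x k) ^ (1 / p) with hM
  have hM0 : 0 ≤ M := Real.rpow_nonneg (trAbsPow_nonneg p _) _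
  calc ∑ i, ‖x k i 0 + x k 0 i‖ ^ q
      ≤ ∑ i, (2 * (‖x k i 0‖ ^ 2 + ‖x k 0 i‖ ^ 2)) ^ (q / 2) := by
        refine Finset.sum_le_sum fun i _ => ?_
        have : ‖x k i 0 + x k 0 i‖ ^ q = (‖x k i 0 + x k 0 i‖ ^ (2 : ℝ)) ^ (q / 2) := by
          rw [← Real.rpow_mul (norm_nonneg _)]
          congr 1
          ring
        rw [this, Real.rpow_two]
        refine Real.rpow_le_rpow (by positivity) ?_ (by linarith)
        have h2 := norm_add_le (x k i 0) (x k 0 i)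
        nlinarith [norm_nonneg (x k i 0 + x k 0 i), sq_nonneg (‖x k i 0‖ - ‖x k 0 i‖)]
    _ ≤ (∑ i, 2 * (‖x k i 0‖ ^ 2 + ‖x k 0 i‖ ^ 2)) ^ (q / 2) :=
        sum_rpow_le (fun i => by positivity) (by linarith)
    _ ≤ ((2 * M) ^ (2 : ℝ)) ^ (q / 2) := by
        refine Real.rpow_le_rpow (Finset.sum_nonneg fun i _ => by positivity) ?_ (by linarith)
        rw [← Finset.mul_sum, Finset.sum_add_distrib, Real.rpow_two]
        have h2 := sum_norm_col_sq_le hp (x k) 0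
        have h3 := sum_norm_row_sq_le hp (x k) 0
        rw [← hM] at h2 h3
        linarith
    _ = 2 ^ q * trAbsPow p (x k) ^ (q / p) := by
        rw [← Real.rpow_mul (by positivity), mul_div_cancel₀ _ two_ne_zero,
          Real.mul_rpow zero_le_two hM0, hM, ← Real.rpow_mul (trAbsPow_nonneg p _)]
        congr 2
        ring

/-- The map that sums the first column and the first row of every block. -/
def colAddRow {p q : ℝ} [hp : Fact (1 ≤ p)] [Fact (1 ≤ q)] (hpq : 2 * p < q) :
    LpM p →ₗ[ℂ] LqN q where
  toFun x := ⟨fun s => of fun _ _ => x.1 s.1 s.2 0 + x.1 s.1 0 s.2, by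
    have hp1 := hp.out
    change Summable _
    simpa only [trAbsPow_unique, of_apply] using
      summable_norm_col_add_row hp1 (by linarith) (by linarith) x.2⟩
  map_add' x y := by
    apply Subtype.ext
    funext s
    ext
    simp
    ring
  map_smul' c x := by
    apply Subtype.ext
    funext s
    ext
    simp
    ring

variable {p q : ℝ} [hp : Fact (1 ≤ p)] [hq : Fact (1 ≤ q)] (hpq : 2 * p < q)

theorem colAddRow_apply (x : LpM p) (k : ℕ) (i : Fin (k + 1)) (a b : Unit) :
    (colAddRow (q := q) hpq x).1 ⟨k, i⟩ a b = x.1 k i 0 + x.1 k 0 i := rfl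

end RowColumn

/-! ### Diagonals of positive elements -/

section Diagonal

theorem IsPos.apply_self_nonneg {ι : Type*} {d : ι → Type*} [∀ k, Fintype (d k)]
    [∀ k, DecidableEq (d k)] {p : ℝ} [Fact (1 ≤ p)] {f : BlockLp d p} (hf : IsPos f) (k : ι)
    (i : d k) : 0 ≤ (f.1 k i i).re ∧ f.1 k i i = ((f.1 k i i).re : ℂ) := by
  have h := (hf k).diag_nonneg (i := i)
  exact ⟨(Complex.nonneg_iff.1 h).1, Complex.eq_re_of_ofReal_le h⟩

variable {p q : ℝ}

theorem summable_diag_rpow [hp : Fact (1 ≤ p)] {f : LpM p} (hf : IsPos f) :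
    Summable (fun s : (Σ k : ℕ, Fin (k + 1)) => (f.1 s.1 s.2 s.2).re ^ p) ∧
      (∑' s : (Σ k : ℕ, Fin (k + 1)), (f.1 s.1 s.2 s.2).re ^ p) ^ (1 / p) ≤ lpNorm f := by
  have hp1 := hp.out
  have h0 : ∀ k i, 0 ≤ (f.1 k i i).re ^ p := fun k i =>
    Real.rpow_nonneg (hf.apply_self_nonneg k i).1 p
  have hle : ∀ k, ∑ i, (f.1 k i i).re ^ p ≤ trAbsPow p (f.1 k) := by
    intro k
    refine (Finset.sum_le_sum fun i _ => ?_).trans (sum_norm_diag_rpow_le hp1 (f.1 k))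
    exact Real.rpow_le_rpow (hf.apply_self_nonneg k i).1 (Complex.re_le_norm _) (by linarith)
  have hs : Summable fun k => ∑ i, (f.1 k i i).re ^ p :=
    Summable.of_nonneg_of_le (fun k => Finset.sum_nonneg fun i _ => h0 k i) hle f.2
  have hsum : Summable (fun s : (Σ k : ℕ, Fin (k + 1)) => (f.1 s.1 s.2 s.2).re ^ p) := by
    refine (summable_sigma_of_nonneg
      (f := fun s : (Σ k : ℕ, Fin (k + 1)) => (f.1 s.1 s.2 s.2).re ^ p) fun s => h0 s.1 s.2).2
      ⟨fun k => (hasSum_fintype _).summable, ?_⟩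
    simpa only [tsum_fintype] using hs
  refine ⟨hsum, Real.rpow_le_rpow (tsum_nonneg fun s => h0 s.1 s.2) ?_ (by positivity)⟩
  rw [hsum.tsum_sigma]
  simp only [tsum_fintype]
  exact hs.tsum_le_tsum hle f.2

/-- The `q`-th power splits as `D_i^{q/2} D_0^{q/2}`. The second factor is at most `H^{q/(2p)}`, and
so is the sum of the first ones, because `q/(2p) ≥ 1`. -/
theorem summable_sqrt_mul_rpow {D : (Σ k : ℕ, Fin (k + 1)) → ℝ} {N : ℝ} (hp1 : 1 ≤ p)
    (hpq : 2 * p < q) (hD : ∀ s, 0 ≤ D s) (hsum : Summable fun s => D s ^ p)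
    (hN : (∑' s, D s ^ p) ^ (1 / p) ≤ N) :
    Summable (fun s => √(D s * D ⟨s.1, 0⟩) ^ q) ∧
      (∑' s, √(D s * D ⟨s.1, 0⟩) ^ q) ^ (1 / q) ≤ N := by
  have hp0 : 0 < p := by linarith
  have hq0 : 0 < q := by linarith
  have hD' : ∀ s, 0 ≤ D s ^ p := fun s => Real.rpow_nonneg (hD s) p
  set H := ∑' s, D s ^ p with hH
  have hH0 : 0 ≤ H := tsum_nonneg hD'
  obtain ⟨h1, h2⟩ := summable_rpow_and_tsum_rpow_le (r := q / (2 * p)) hD' hsum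
    ((one_le_div (by positivity)).2 hpq.le)
  have hr : ∀ s, (D s ^ p) ^ (q / (2 * p)) = D s ^ (q / 2) := by
    intro s
    rw [← Real.rpow_mul (hD s)]
    congr 1
    field_simp
  have hle0 : ∀ s, D s ^ (q / 2) ≤ H ^ (q / (2 * p)) := by
    intro s
    rw [← hr]
    exact Real.rpow_le_rpow (hD' s) (hsum.le_tsum s fun j _ => hD' j) (by positivity)
  simp only [hr] at h1 h2
  have hsq : ∀ s, √(D s * D ⟨s.1, 0⟩) ^ q = D s ^ (q / 2) * D ⟨s.1, 0⟩ ^ (q / 2) := by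
    intro s
    rw [Real.sqrt_eq_rpow, ← Real.rpow_mul (mul_nonneg (hD _) (hD _)),
      Real.mul_rpow (hD _) (hD _)]
    congr 2 <;> ring
  have hle : ∀ s, √(D s * D ⟨s.1, 0⟩) ^ q ≤ D s ^ (q / 2) * H ^ (q / (2 * p)) := by
    intro s
    rw [hsq]
    exact mul_le_mul_of_nonneg_left (hle0 _) (Real.rpow_nonneg (hD s) _)
  have h3 : Summable fun s => D s ^ (q / 2) * H ^ (q / (2 * p)) := h1.mul_right _
  have h4 : Summable fun s => √(D s * D ⟨s.1, 0⟩) ^ q :=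
    Summable.of_nonneg_of_le (fun s => by positivity) hle h3
  refine ⟨h4, le_trans ?_ hN⟩
  have h5 : ∑' s, √(D s * D ⟨s.1, 0⟩) ^ q ≤ H ^ (q / p) := by
    refine (h4.tsum_le_tsum hle h3).trans ?_
    rw [tsum_mul_right]
    refine (mul_le_mul_of_nonneg_right h2 (by positivity)).trans (le_of_eq ?_)
    rw [← Real.rpow_add_of_nonneg hH0 (by positivity) (by positivity)]
    congr 1
    field_simp
    norm_num
  refine (Real.rpow_le_rpow (tsum_nonneg fun s => by positivity) h5 (by positivity)).trans
    (le_of_eq ?_)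
  rw [← Real.rpow_mul hH0]
  congr 1
  field_simp

end Diagonal

/-! ### The completely order bounded norm -/

section CobBound

variable {p q : ℝ} [hp : Fact (1 ≤ p)] [hq : Fact (1 ≤ q)] (hpq : 2 * p < q)

/-- A principal submatrix suffices: keep the matrix index `r` in the upper half and `c` in the lower
half. -/
theorem submatrix_block {ι : Type*} {d : ι → Type*} [∀ k, Fintype (d k)]
    [∀ k, DecidableEq (d k)] {f g : BlockLp d p} {n : ℕ}
    {x : Matrix (Fin n) (Fin n) (BlockLp d p)} (hf : IsPos f) (hg : IsPos g)
    (h : MatPos (fromBlocks (diagonal fun _ => f) x xᴴ (diagonal fun _ => g)))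
    (k : ι) (r c : d k) :
    (fromBlocks ((((f.1 k r r).re : ℝ) : ℂ) • 1) (of fun i j => (x i j).1 k r c)
      (of fun i j => (x i j).1 k r c)ᴴ ((((g.1 k c c).re : ℝ) : ℂ) • 1)).PosSemidef := by
  have h1 := (h k).submatrix (Sum.elim (fun i : Fin n => (Sum.inl i, r))
    (fun i : Fin n => (Sum.inr i, c)))
  convert h1 using 1
  ext (i | i) (j | j)
  · by_cases hij : i = j
    · simp [hij, ← (hf.apply_self_nonneg k r).2]
    · simp [hij]
  · simp
  · simp only [fromBlocks_apply₂₁, submatrix_apply, of_apply, Sum.elim_inl, Sum.elim_inr,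
      conjTranspose_apply]
    rfl
  · by_cases hij : i = j
    · simp [hij, ← (hg.apply_self_nonneg k c).2]
    · simp [hij]

theorem matrixNorm_map_colAddRow_le {n : ℕ} (x : Matrix (Fin n) (Fin n) (LpM p)) :
    matrixNorm (x.map (colAddRow (q := q) hpq)) ≤ 2 * matrixNorm x := by
  have hp1 := hp.out
  rw [← ENNReal.div_le_iff' two_ne_zero ENNReal.ofNat_ne_top]
  refine le_iInf fun f => le_iInf fun g => le_iInf fun hf => le_iInf fun hg => le_iInf fun h => ?_
  rw [ENNReal.div_le_iff' two_ne_zero ENNReal.ofNat_ne_top]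
  let D : (Σ k : ℕ, Fin (k + 1)) → ℝ := fun s => (f.1 s.1 s.2 s.2).re + (g.1 s.1 s.2 s.2).re
  have hf0 := fun s : (Σ k : ℕ, Fin (k + 1)) => (hf.apply_self_nonneg s.1 s.2).1
  have hg0 := fun s : (Σ k : ℕ, Fin (k + 1)) => (hg.apply_self_nonneg s.1 s.2).1
  have hD : ∀ s, 0 ≤ D s := fun s => add_nonneg (hf0 s) (hg0 s)
  obtain ⟨hfs, hfN⟩ := summable_diag_rpow hf
  obtain ⟨hgs, hgN⟩ := summable_diag_rpow hg
  obtain ⟨hDs, hDN⟩ := Real.Lp_add_le_tsum_of_nonneg hp1 hf0 hg0 hfs hgs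
  obtain ⟨hFs, hFN⟩ := summable_sqrt_mul_rpow hp1 hpq hD hDs
    (hDN.trans (add_le_add hfN hgN))
  have hnorm : ∀ s : (Σ k : ℕ, Fin (k + 1)),
      trAbsPow q (of fun _ _ : Unit => (√(D s * D ⟨s.1, 0⟩) : ℂ)) = √(D s * D ⟨s.1, 0⟩) ^ q := by
    intro s
    rw [trAbsPow_unique, of_apply, Complex.norm_real, Real.norm_of_nonneg (Real.sqrt_nonneg _)]
  let F : LqN q := ⟨fun s => of fun _ _ => (√(D s * D ⟨s.1, 0⟩) : ℂ), by
    change Summable _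
    simpa only [hnorm] using hFs⟩
  have hFn : lpNorm F ≤ lpNorm f + lpNorm g := by
    simpa only [lpNorm, F, hnorm] using hFN
  have hF : IsPos F := by
    intro s
    have : F.1 s = diagonal fun _ => (√(D s * D ⟨s.1, 0⟩) : ℂ) := by
      ext
      simp [F]
    rw [this, posSemidef_diagonal_iff]
    intro _
    exact_mod_cast Real.sqrt_nonneg _
  have hpos : MatPos (fromBlocks (diagonal fun _ => F) (x.map (colAddRow (q := q) hpq))
      (x.map (colAddRow (q := q) hpq))ᴴ (diagonal fun _ => F)) := by
    rintro ⟨k, i⟩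
    have h1 := posSemidef_fromBlocks_smul_one_add (submatrix_block hf hg h k i 0)
      (submatrix_block hf hg h k 0 i) (hf0 ⟨k, i⟩) (hg0 ⟨k, 0⟩) (hf0 ⟨k, 0⟩) (hg0 ⟨k, i⟩)
    have h2 := h1.submatrix (Prod.fst : (Fin n ⊕ Fin n) × Unit → Fin n ⊕ Fin n)
    convert h2 using 1
    have hsqrt : √(D ⟨k, i⟩ * D ⟨k, 0⟩) = √(((f.1 k i i).re + (g.1 k i i).re)
        * ((g.1 k 0 0).re + (f.1 k 0 0).re)) := by
      simp only [D]
      rw [add_comm (g.1 k 0 0).re]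
    ext ⟨a | a, _⟩ ⟨b | b, _⟩
    · by_cases hab : a = b
      · simp [hab, F, hsqrt]
      · simp [hab]
    · simp [colAddRow_apply]
    · simp only [submatrix_apply, of_apply, fromBlocks_apply₂₁, conjTranspose_apply,
        Matrix.add_apply]
      rfl
    · by_cases hab : a = b
      · simp [hab, F, hsqrt]
      · simp [hab]
  -- With `F` in both corners the value is `‖F‖_q ≤ ‖f‖_p + ‖g‖_p`, twice the average that `f` and
  -- `g` contribute; this is the constant `2`.
  refine (iInf_le_of_le F <| iInf_le_of_le F <| iInf_le_of_le hF <| iInf_le_of_le hF <|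
    iInf_le_of_le hpos le_rfl).trans ?_
  rw [← ENNReal.ofReal_ofNat 2, ← ENNReal.ofReal_mul zero_le_two]
  exact ENNReal.ofReal_le_ofReal (by linarith)

theorem cobNorm_colAddRow_le : cobNorm (colAddRow (p := p) (q := q) hpq) ≤ 2 := by
  refine iSup_le fun n => iSup_le fun x => iSup_le fun hx => ?_
  refine (matrixNorm_map_colAddRow_le hpq x).trans ?_
  calc 2 * matrixNorm x ≤ 2 * 1 := by gcongr
    _ = 2 := mul_one 2

end CobBound

/-! ### Positive test elements built from diagonal matrix units -/

theorem posSemidef_single_self {m : Type*} [Fintype m] [DecidableEq m] (i : m) :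
    (single i i (1 : ℂ)).PosSemidef := by
  rw [← diagonal_single, posSemidef_diagonal_iff]
  intro j
  by_cases h : j = i
  · subst h; simp
  · simp [h]

section BlockSingle

variable {ι : Type*} {d : ι → Type*} [∀ k, Fintype (d k)]
  [∀ k, DecidableEq (d k)] {p : ℝ} [hp : Fact (1 ≤ p)]

/-- The element of `L_p` whose only nonzero block is the `k`-th one, equal to `a`. -/
def blockSingle [DecidableEq ι] (p : ℝ) [hp : Fact (1 ≤ p)] (k : ι) : Matrix (d k) (d k) ℂ →ₗ[ℂ] BlockLp d p :=
  (LinearMap.single ℂ (fun k => Matrix (d k) (d k) ℂ) k).codRestrict (BlockLp d p) fun a => by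
    refine summable_of_ne_finset_zero (s := {k}) fun j hj => ?_
    rw [LinearMap.single_apply, Pi.single_eq_of_ne (by simpa using hj), trAbsPow_zero hp.out]

theorem blockSingle_val [DecidableEq ι] (k : ι) (a : Matrix (d k) (d k) ℂ) :
    (blockSingle p k a).1 = Pi.single k a := rfl

theorem isPos_blockSingle [DecidableEq ι] {k : ι} {a : Matrix (d k) (d k) ℂ} (ha : a.PosSemidef) :
    IsPos (blockSingle p k a) := by
  intro j
  rw [blockSingle_val]
  obtain rfl | hj := eq_or_ne j k
  · rwa [Pi.single_eq_same]
  · rw [Pi.single_eq_of_ne hj]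
    exact PosSemidef.zero

/-- The element of `L_p` whose `k`-th block is `c k` times a diagonal matrix unit. -/
def diagUnits (c : ι → ℝ) (i : ∀ k, d k) (hc : Summable fun k => |c k| ^ p) : BlockLp d p :=
  ⟨fun k => (c k : ℂ) • single (i k) (i k) 1, by
    refine Summable.of_nonneg_of_le (fun k => trAbsPow_nonneg p _) (fun k => ?_) hc
    refine (trAbsPow_smul_le hp.out _ _).trans ?_
    rw [Complex.norm_real, Real.norm_eq_abs]
    exact mul_le_of_le_one_right (by positivity) (trAbsPow_single_self_le hp.out _)⟩

theorem isPos_diagUnits {c : ι → ℝ} {i : ∀ k, d k} {hc : Summable fun k => |c k| ^ p}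
    (h0 : ∀ k, 0 ≤ c k) : IsPos (diagUnits c i hc) := fun k =>
  (posSemidef_single_self (i k)).smul (by exact_mod_cast h0 k)

theorem isPos_diagUnits_sub [DecidableEq ι] {c : ι → ℝ} {i : ∀ k, d k} {hc : Summable fun k => |c k| ^ p}
    (h0 : ∀ k, 0 ≤ c k) (k : ι) :
    IsPos (diagUnits c i hc - (c k : ℂ) • blockSingle p k (single (i k) (i k) 1)) := by
  intro j
  have h1 : (diagUnits c i hc - (c k : ℂ) • blockSingle p k (single (i k) (i k) 1)).1 j
      = (diagUnits c i hc).1 j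
        - (c k : ℂ) • Pi.single (M := fun k => Matrix (d k) (d k) ℂ) k (single (i k) (i k) 1) j :=
    rfl
  rw [h1]
  obtain rfl | hj := eq_or_ne j k
  · rw [Pi.single_eq_same]
    have : (diagUnits c i hc).1 j = (c j : ℂ) • single (i j) (i j) 1 := rfl
    rw [this, sub_self]
    exact PosSemidef.zero
  · rw [Pi.single_eq_of_ne hj, smul_zero, sub_zero]
    exact isPos_diagUnits h0 j

end BlockSingle

/-! ### Order consequences of complete positivity -/

section Positive

variable {ι κ : Type*} {d : ι → Type*} [∀ k, Fintype (d k)] [∀ k, DecidableEq (d k)]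
  {d' : κ → Type*} [∀ k, Fintype (d' k)] [∀ k, DecidableEq (d' k)]
  {p q : ℝ} [hp : Fact (1 ≤ p)] [hq : Fact (1 ≤ q)]

theorem CompletelyPositive.isPos {S : BlockLp d p →ₗ[ℂ] BlockLp d' q} (hS : CompletelyPositive S)
    {x : BlockLp d p} (hx : IsPos x) : IsPos (S x) := by
  intro k
  have h := hS 1 (of fun _ _ => x) (fun j => (hx j).submatrix Prod.snd) k
  exact h.submatrix fun i => (0, i)

/-- Apply the map to the positive matrix with all four entries `x`, and evaluate the resulting form
at the vector `(1, 1)`. -/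
theorem CompletelyPositiveTwo.neg_two_mul_re_le {S₁ T S₂ : BlockLp d p →ₗ[ℂ] BlockLp d' q}
    (h : CompletelyPositiveTwo (decompMap S₁ T S₂)) {x : BlockLp d p} (hx : IsPos x) (k : κ)
    (i : d' k) : -(2 * ((T x).1 k i i).re) ≤ ((S₁ x + S₂ x).1 k i i).re := by
  have hstar : star x = x := Subtype.ext (funext fun j => (hx j).isHermitian)
  have h1 := h 1 (of fun _ _ => of fun _ _ => x) (fun j => (hx j).submatrix Prod.snd) k
  have h2 := h1.submatrix (fun a : Fin 2 => (((0 : Fin 1), a), i))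
  have h3 := h2.dotProduct_mulVec_nonneg ![1, 1]
  have h4 := (Complex.nonneg_iff.1 h3).1
  have h5 : ((star (T x)).1 k i i).re = ((T x).1 k i i).re := by
    change (star ((T x).1 k i i)).re = _
    simp
  have h6 : ((S₁ x + S₂ x).1 k i i).re = ((S₁ x).1 k i i).re + ((S₂ x).1 k i i).re := rfl
  simp [dotProduct, mulVec, Fin.sum_univ_two, decompMap, hstar] at h4
  rw [h6]
  linarith

end Positive

/-! ### Failure of decomposability -/

theorem single_self_eq_vecMulVec {m : Type*} [DecidableEq m] (i : m) :
    single i i (1 : ℂ) = vecMulVec (Pi.single i 1) (star (Pi.single i 1)) := by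
  ext a b
  by_cases ha : i = a <;> by_cases hb : i = b <;>
    simp [vecMulVec_apply, single_apply, Pi.single_apply, ha, hb, eq_comm]

theorem sq_le_mul_of_forall_two_mul_le {w a b ε φ₀ φ₁ : ℝ} (hw : 0 < w) (h₀ : w * φ₀ ≤ a)
    (h₁ : w * φ₁ ≤ b) (h : ∀ t, 2 * t ≤ φ₀ + t ^ 2 * φ₁) (ha : a ≤ ε) (hε : 0 < ε) :
    w ^ 2 ≤ b * ε := by
  -- With `wt = ε` one gets `φ₀ ≤ t`, so half of `2t` must come from `t² φ₁`.
  obtain ⟨t, ht, rfl⟩ : ∃ t, 0 < t ∧ w * t = ε := ⟨ε / w, by positivity, by field_simp⟩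
  have h2 : φ₀ ≤ t := le_of_mul_le_mul_left (h₀.trans ha) hw
  have h3 : t * 1 ≤ t * (t * φ₁) := by linarith [h t]
  have h4 : 1 ≤ t * φ₁ := le_of_mul_le_mul_left h3 ht
  calc w ^ 2 = w ^ 2 * 1 := (mul_one _).symm
    _ ≤ w ^ 2 * (t * φ₁) := by gcongr
    _ = w * φ₁ * (w * t) := by ring
    _ ≤ b * (w * t) := mul_le_mul_of_nonneg_right h₁ hε.le

section NotDecomposable

variable {p q : ℝ} [hp : Fact (1 ≤ p)] [hq : Fact (1 ≤ q)]

/-- Add `S(y_t) ≥ 0` to `S(y_{-t}) ≥ -2 T(y_{-t})`, which is `4t` in coordinate `i`. In `y_t +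
y_{-t}` the off-diagonal terms cancel. -/
theorem two_mul_le_of_dominates (hpq : 2 * p < q) {S : LpM p →ₗ[ℂ] LqN q}
    (hS : ∀ x, IsPos x → IsPos (S x))
    (hT : ∀ x, IsPos x → ∀ s, -(2 * ((colAddRow hpq x).1 s () ()).re) ≤ ((S x).1 s () ()).re)
    {k : ℕ} {i : Fin (k + 1)} (hi : i ≠ 0) (t : ℝ) :
    2 * t ≤ ((S (blockSingle p k (single 0 0 1))).1 ⟨k, i⟩ () ()).re
      + t ^ 2 * ((S (blockSingle p k (single i i 1))).1 ⟨k, i⟩ () ()).re := by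
  let v : ℝ → Fin (k + 1) → ℂ := fun r => Pi.single 0 1 + (r : ℂ) • Pi.single i 1
  let y : ℝ → LpM p := fun r => blockSingle p k (vecMulVec (v r) (star (v r)))
  have hy : ∀ r, IsPos (y r) := fun r => isPos_blockSingle (posSemidef_vecMulVec_self_star _)
  have h1 := ((hS _ (hy t)).apply_self_nonneg ⟨k, i⟩ ()).1
  have h2 := hT _ (hy (-t)) ⟨k, i⟩
  have h3 : ((colAddRow hpq (y (-t))).1 ⟨k, i⟩ () ()).re = -(2 * t) := by
    have h30 : (y (-t)).1 k = vecMulVec (v (-t)) (star (v (-t))) := by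
      simp only [y, blockSingle_val, Pi.single_eq_same]
    rw [colAddRow_apply, h30]
    simp [vecMulVec_apply, v, hi, hi.symm]
    ring
  have h4 : y t + y (-t) = (2 : ℂ) • (blockSingle p k (single 0 0 1) : LpM p)
      + ((2 * t ^ 2 : ℝ) : ℂ) • (blockSingle p k (single i i 1) : LpM p) := by
    simp only [y, ← map_add, ← map_smul]
    congr 1
    rw [single_self_eq_vecMulVec, single_self_eq_vecMulVec]
    ext a b
    simp only [v, Matrix.add_apply, Matrix.smul_apply, vecMulVec_apply, Pi.add_apply,
      Pi.smul_apply, Pi.star_apply, star_add, star_smul, smul_eq_mul, RCLike.star_def,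
      Complex.conj_ofReal]
    push_cast
    ring
  have h5 : ((S (y t)).1 ⟨k, i⟩ () ()).re + ((S (y (-t))).1 ⟨k, i⟩ () ()).re
      = 2 * ((S (blockSingle p k (single 0 0 1))).1 ⟨k, i⟩ () ()).re
        + 2 * t ^ 2 * ((S (blockSingle p k (single i i 1))).1 ⟨k, i⟩ () ()).re := by
    have h50 := congrArg (fun z => ((S z).1 ⟨k, i⟩ () ()).re) h4
    simp only [map_add, map_smul] at h50
    refine Eq.trans ?_ (h50.trans ?_)
    · rfl
    · change ((2 : ℂ) * _ + ((2 * t ^ 2 : ℝ) : ℂ) * _ : ℂ).re = _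
      rw [Complex.add_re, Complex.re_ofReal_mul]
      simp
  linarith

theorem not_exists_positive_dominates (hpq : 2 * p < q) {S : LpM p →ₗ[ℂ] LqN q}
    (hS : ∀ x, IsPos x → IsPos (S x))
    (hT : ∀ x, IsPos x → ∀ s, -(2 * ((colAddRow hpq x).1 s () ()).re) ≤ ((S x).1 s () ()).re) :
    False := by
  have hq0 : 0 < q := by linarith [hq.out]
  have hp0 : 0 < p := by linarith [hp.out]
  have hsum : ∀ x : LpM p, IsPos x →
      Summable fun s : (Σ k : ℕ, Fin (k + 1)) => ((S x).1 s () ()).re ^ q := by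
    intro x hx
    have h : Summable _ := (S x).2
    simp only [trAbsPow_unique] at h
    refine h.congr fun s => ?_
    obtain ⟨h1, h2⟩ := (hS x hx).apply_self_nonneg s ()
    change ‖(S x).1 s () ()‖ ^ q = _
    rw [h2, Complex.norm_real, Real.norm_of_nonneg h1, Complex.ofReal_re]
  -- At `k = K^j` the weight is `2^{-j}`, so `K ≥ 4^q` is exactly what makes `c_k^{2q} k ≥ 1`, while
  -- the weights remain `p`-summable.
  obtain ⟨K, hK⟩ : ∃ K : ℕ, (4 : ℝ) ^ q ≤ K := exists_nat_ge _
  have hK1 : 1 < K := by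
    have : (1 : ℝ) < 4 ^ q := Real.one_lt_rpow (by norm_num) hq0
    exact_mod_cast this.trans_le hK
  have hinj : Function.Injective fun j : ℕ => K ^ j := Nat.pow_right_injective hK1
  let c : ℕ → ℝ := Function.extend (fun j : ℕ => K ^ j) (fun j => (1 / 2) ^ j) 0
  have hcK : ∀ j, c (K ^ j) = (1 / 2) ^ j := fun j => hinj.extend_apply _ _ j
  have hc' : ∀ k, k ∉ Set.range (fun j : ℕ => K ^ j) → c k = 0 := fun k hk =>
    Function.extend_apply' _ _ _ (by simpa using hk)
  have hc0 : ∀ k, 0 ≤ c k := by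
    intro k
    by_cases hk : k ∈ Set.range fun j : ℕ => K ^ j
    · obtain ⟨j, rfl⟩ := hk
      simp only [hcK]
      positivity
    · rw [hc' k hk]
  have hc : Summable fun k => |c k| ^ p := by
    rw [← hinj.summable_iff]
    · refine Summable.of_nonneg_of_le (fun j => Real.rpow_nonneg (abs_nonneg _) p) (fun j => ?_)
        (summable_geometric_of_lt_one (by norm_num) (by norm_num : (1 / 2 : ℝ) < 1))
      have h1 : |c (K ^ j)| = (1 / 2) ^ j := by rw [abs_of_nonneg (hc0 _), hcK]
      simp only [Function.comp_apply, h1]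
      exact Real.rpow_le_self_of_le_one (by positivity)
        (pow_le_one₀ (by norm_num) (by norm_num)) hp.out
    · intro k hk
      rw [hc' k hk, abs_zero, Real.zero_rpow hp0.ne']
  have hmono : ∀ (i : ∀ k, Fin (k + 1)) (s : Σ k : ℕ, Fin (k + 1)),
      c s.1 * ((S (blockSingle p s.1 (single (i s.1) (i s.1) 1))).1 s () ()).re
        ≤ ((S (diagUnits c i hc)).1 s () ()).re := by
    intro i s
    -- Deleting all other blocks leaves a smaller positive element, and `S` is monotone.
    have h := ((hS _ (isPos_diagUnits_sub (i := i) (hc := hc) hc0 s.1)).apply_self_nonneg s ()).1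
    rw [map_sub, map_smul] at h
    have h1 : 0 ≤ ((S (diagUnits c i hc)).1 s () ()
      - (c s.1 : ℂ) * (S (blockSingle p s.1 (single (i s.1) (i s.1) 1))).1 s () ()).re := h
    rw [Complex.sub_re, Complex.re_ofReal_mul] at h1
    linarith
  set x₀ : LpM p := diagUnits c (fun _ => 0) hc with hx₀
  have hx₀p : IsPos x₀ := isPos_diagUnits hc0
  have hs₀ := hsum x₀ hx₀p
  have hnn : ∀ s, 0 ≤ ((S x₀).1 s () ()).re := fun s => ((hS _ hx₀p).apply_self_nonneg s ()).1
  -- The added `1` makes `A` positive and yields the contradiction `A ≤ A - 1` in the pigeonhole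
  -- step.
  set A := (∑' s : (Σ k : ℕ, Fin (k + 1)), ((S x₀).1 s () ()).re ^ q) + 1 with hA
  have hA0 : 0 < A :=
    add_pos_of_nonneg_of_pos (tsum_nonneg fun s => Real.rpow_nonneg (hnn s) q) one_pos
  -- Block `k` has size `k + 1`, hence exactly `k` coordinates other than `0`; one of them carries
  -- at most the share `A / k`. For `k = 0` there is none, hence the guard.
  have hex : ∀ k : ℕ, ∃ i : Fin (k + 1), 0 < k →
      i ≠ 0 ∧ ((S x₀).1 ⟨k, i⟩ () ()).re ^ q * k ≤ A := by
    intro k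
    by_contra! hcon
    obtain ⟨hk, -⟩ := hcon 0
    have h1 : ∀ j : Fin k, A / k < ((S x₀).1 ⟨k, j.succ⟩ () ()).re ^ q := by
      intro j
      rw [div_lt_iff₀ (by exact_mod_cast hk)]
      exact (hcon j.succ).2 (Fin.succ_ne_zero j)
    have h2 : ∑ j : Fin k, ((S x₀).1 ⟨k, j.succ⟩ () ()).re ^ q ≤ A - 1 := by
      have hinj' : Function.Injective fun j : Fin k => (⟨k, j.succ⟩ : Σ k : ℕ, Fin (k + 1)) := by
        intro a b hab
        simpa using hab
      have h20 := tsum_comp_le_tsum_of_inj hs₀ (fun s => Real.rpow_nonneg (hnn s) q) hinj'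
      rw [tsum_fintype] at h20
      simpa [hA, Function.comp_def] using h20
    have h3 : ∑ _j : Fin k, A / k ≤ A - 1 :=
      (Finset.sum_le_sum fun j _ => (h1 j).le).trans h2
    have hk' : (k : ℝ) ≠ 0 := by exact_mod_cast hk.ne'
    rw [Finset.sum_const, Finset.card_univ, Fintype.card_fin, nsmul_eq_mul,
      mul_div_cancel₀ _ hk'] at h3
    linarith
  choose i hi using hex
  have hx₁p : IsPos (diagUnits (p := p) c i hc) := isPos_diagUnits hc0
  have hs₁ := hsum _ hx₁p
  have hlow : ∀ j : ℕ, 1 / A ≤ ((S (diagUnits c i hc)).1 ⟨K ^ j, i (K ^ j)⟩ () ()).re ^ q := by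
    intro j
    have hKj : 0 < K ^ j := by positivity
    obtain ⟨hi0, hiA⟩ := hi (K ^ j) hKj
    have hm₀ := hmono (fun _ => 0) ⟨K ^ j, i (K ^ j)⟩
    have hm₁ := hmono i ⟨K ^ j, i (K ^ j)⟩
    have h2t := two_mul_le_of_dominates hpq hS hT hi0
    simp only [hcK] at hm₀ hm₁
    rw [← hx₀] at hm₀
    set a := ((S x₀).1 ⟨K ^ j, i (K ^ j)⟩ () ()).re with ha
    set b := ((S (diagUnits c i hc)).1 ⟨K ^ j, i (K ^ j)⟩ () ()).re
    set φ₀ := ((S (blockSingle p (K ^ j) (single 0 0 1))).1 ⟨K ^ j, i (K ^ j)⟩ () ()).re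
    set φ₁ := ((S (blockSingle p (K ^ j) (single (i (K ^ j)) (i (K ^ j)) 1))).1
      ⟨K ^ j, i (K ^ j)⟩ () ()).re
    have ha0 : 0 ≤ a := hnn _
    have hw : (0 : ℝ) < (1 / 2) ^ j := by positivity
    set ε := (A / (K ^ j : ℕ)) ^ (1 / q) with hεdef
    have hKj' : (0 : ℝ) < (K ^ j : ℕ) := by exact_mod_cast hKj
    have hε0 : 0 < ε := Real.rpow_pos_of_pos (div_pos hA0 hKj') _
    have hεq : ε ^ q = A / (K ^ j : ℕ) := by
      rw [hεdef, ← Real.rpow_mul (div_pos hA0 hKj').le, one_div_mul_cancel hq0.ne', Real.rpow_one]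
    have haε : a ≤ ε := by
      rwa [← Real.rpow_le_rpow_iff ha0 hε0.le hq0, hεq, le_div_iff₀ hKj']
    have hb := sq_le_mul_of_forall_two_mul_le hw hm₀ hm₁ h2t haε hε0
    have hb0 : 0 < b := by
      by_contra! hneg
      nlinarith [pow_pos hw 2]
    have hbq := Real.rpow_le_rpow (by positivity) hb hq0.le
    rw [Real.mul_rpow hb0.le hε0.le, hεq] at hbq
    -- From `w² ≤ bε` and `ε^q = A / K^j` follows `b^q ≥ w^{2q} K^j / A`, so this gives `b^q ≥ 1 /
    -- A` for every `j`.
    have hw4 : (((1 / 2 : ℝ) ^ j) ^ 2) ^ q * (K ^ j : ℕ) ≥ 1 := by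
      have h1 : (((1 / 2 : ℝ) ^ j) ^ 2) ^ q = (((4 : ℝ) ^ q) ^ j)⁻¹ := by
        rw [← Real.rpow_natCast (4 ^ q) j, ← Real.rpow_mul (by norm_num), mul_comm q,
          Real.rpow_mul (by norm_num), ← Real.inv_rpow (by positivity), Real.rpow_natCast]
        congr 1
        rw [← pow_mul, mul_comm j, pow_mul, ← inv_pow]
        norm_num
      rw [h1, Nat.cast_pow, ge_iff_le, ← div_eq_inv_mul, one_le_div (by positivity)]
      exact pow_le_pow_left₀ (by positivity) hK j
    rw [div_le_iff₀ hA0]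
    rw [mul_div_assoc', le_div_iff₀ hKj'] at hbq
    linarith
  have hinj₂ : Function.Injective
      fun j : ℕ => (⟨K ^ j, i (K ^ j)⟩ : Σ k : ℕ, Fin (k + 1)) := fun a b hab =>
    hinj (congrArg Sigma.fst hab)
  have htend := (hs₁.comp_injective hinj₂).tendsto_atTop_zero
  obtain ⟨j, hj⟩ := (htend.eventually_lt_const (one_div_pos.2 hA0)).exists
  exact (hlow j).not_gt hj

theorem not_decomposable_colAddRow (hpq : 2 * p < q) :
    ¬ Decomposable (colAddRow (p := p) (q := q) hpq) := by
  rintro ⟨S₁, S₂, h₁, h₂, h⟩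
  refine not_exists_positive_dominates hpq (S := S₁ + S₂) (fun x hx k => ?_)
    fun x hx s => h.neg_two_mul_re_le hx s ()
  exact (h₁.isPos hx k).add (h₂.isPos hx k)

end NotDecomposable

end NCLp

end

theorem mainTheorem3 (p q : ℝ) [Fact (1 ≤ p)] [Fact (1 ≤ q)] (hpq : 2 * p < q) :
    ∃ T : NCLp.LpM p →ₗ[ℂ] NCLp.LqN q,
      (∀ (x : NCLp.LpM p) (k : ℕ) (i : Fin (k + 1)),
        (T x).1 ⟨k, i⟩ () () =
          Matrix.trace ((Matrix.single 0 i (1 : ℂ) + Matrix.single i 0 (1 : ℂ)) * x.1 k)) ∧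
      NCLp.CompletelyOrderBounded T ∧ NCLp.cobNorm T ≤ 2 ∧
      ¬ NCLp.Decomposable T := by
  have hcob := NCLp.cobNorm_colAddRow_le (p := p) (q := q) hpq
  refine ⟨NCLp.colAddRow hpq, fun x k i => ?_, hcob.trans_lt ENNReal.ofNat_lt_top, hcob,
    NCLp.not_decomposable_colAddRow hpq⟩
  rw [NCLp.colAddRow_apply, Matrix.add_mul, Matrix.trace_add, Matrix.trace_single_mul,
    Matrix.trace_single_mul, one_smul, one_smul]
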